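/- Fix a set $K$. A Kripke model $\mathfrak M=\langle W,R,\{P_k\}_{k\in K}\rangle$ consists of a nonempty set $W$, a binary relation $R$ on $W$ and a subset $P_k\subseteq W$ for each $k\in K$; it is identified with a structure for first-order logic with equality over the signature with one binary predicate symbol $\mathbf R$ and unary predicate symbols $\mathbf P_k$ ($k\in K$). The disjoint union $\mathfrak M\uplus\mathfrak M'$ is the Kripke model on the disjoint union of the sets of worlds in which accessibility and the predicates are those inherited from $\mathfrak M$ and $\mathfrak M'$, with no accessibility between the two parts. Let $\smile,\frown$ be two unary connectives (negations) and let $\circ_\smile,\circ_\frown,\bullet_\smile,\bullet_\frown$ be four further unary connectives (their restoration companions). A restorative similarity type is a subset $\Lambda$ of these six connectives. Let $\mathcal L_{\sim,\Lambda}$ be the language generated by $$\phi ::= p_k \mid \top \mid \bot \mid \phi\wedge\phi \mid \phi\vee\phi \mid {\sim}\phi \mid \ast\,\phi \qquad (k\in K,\ \ast\in\Lambda).$$ Its standard translation into first-order logic is given by $\mathrm{st}(x,p_k)=\mathbf P_kx$, $\mathrm{st}(x,\top)=(x=x)$, $\mathrm{st}(x,\bot)={\sim}(x=x)$, by commuting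 with $\wedge,\vee,{\sim}$, and by - $\mathrm{st}(x,\smile\phi)=\exists y(x\mathbf Ry\wedge{\sim}\mathrm{st}(y,\phi))$, - $\mathrm{st}(x,\frown\phi)=\forall y(x\mathbf Ry\to{\sim}\mathrm{st}(y,\phi))$, - $\mathrm{st}(x,\circ_\smile\phi)={\sim}\mathrm{st}(x,\phi)\vee\forall y(x\mathbf Ry\to\mathrm{st}(y,\phi))$, - $\mathrm{st}(x,\circ_\frown\phi)=\mathrm{st}(x,\phi)\vee\forall y(x\mathbf Ry\to{\sim}\mathrm{st}(y,\phi))$, - $\mathrm{st}(x,\bullet_\smile\phi)=\mathrm{st}(x,\phi)\wedge\exists y(x\mathbf Ry\wedge{\sim}\mathrm{st}(y,\phi))$, - $\mathrm{st}(x,\bullet_\frown\phi)={\sim}\mathrm{st}(x,\phi)\wedge\exists y(x\mathbf Ry\wedge\mathrm{st}(y,\phi))$. A symmetrical $\Lambda$-simulation on a Kripke model $\langle W,R,\{P_k\}_{k\in K}\rangle$ is a symmetric relation $S\subseteq W\times W$ such that $(w,v)\in S$ and $w\in P_k$ imply $v\in P_k$ for every $k\in K$, and which satisfies the condition below of each connective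 that belongs to $\Lambda$, for all worlds involved: - $\smile$: if $(w,v)\in S$ and $wRs$, then there is $t$ with $vRt$ and $(t,s)\in S$; - $\frown$: if $(w,v)\in S$ and $vRt$, then there is $s$ with $wRs$ and $(t,s)\in S$; - $\circ_\smile$: if $(w,v)\in S$ and $vRt$, then $(v,t)\in S$, or both $(v,w)\in S$ and there is $s$ with $wRs$ and $(s,t)\in S$; - $\circ_\frown$: if $(w,v)\in S$ and $vRt$, then $(t,v)\in S$, or there is $s$ with $wRs$ and $(t,s)\in S$; - $\bullet_\smile$: if $(w,v)\in S$ and $wRs$, then $(w,s)\in S$, or there is $t$ with $vRt$ and $(t,s)\in S$; - $\bullet_\frown$: if $(w,v)\in S$ and $wRs$, then $(s,w)\in S$, or both $(v,w)\in S$ and there is $t$ with $vRt$ and $(s,t)\in S$. A symmetrical $\Lambda$-simulation between Kripke models $\mathfrak M$ and $\mathfrak M'$ is a symmetrical $\Lambda$-simulation on $\mathfrak M\uplus\mathfrak M'$. A first-order formula $\alpha(x)$ with at most the variable $x$ free is invariant under symmetrical $\Lambda$-simulations if for all Kripke models $\mathfrak M,\mathfrak M'$, every symmetrical $\Lambda$-simulation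 $S$ between them, and all worlds $w$ of $\mathfrak M$ and $w'$ of $\mathfrak M'$ with $(w,w')\in S$, $$\mathfrak M\Vdash\alpha(x)[w]\iff\mathfrak M'\Vdash\alpha(x)[w'].$$ **Theorem.** Let $\Lambda$ be a restorative similarity type and let $\alpha(x)$ be a first-order formula (over the above signature, with equality) with one free variable $x$. Then $\alpha(x)$ is equivalent (that is, true at the same worlds of all Kripke models) to $\mathrm{st}(x,\phi)$ for some $\mathcal L_{\sim,\Lambda}$-formula $\phi$ if and only if $\alpha(x)$ is invariant under symmetrical $\Lambda$-simulations. -/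

import Mathlib

universe u v

namespace Restorative



/-! ### Kripke models -/

/-- A Kripke model over a set `K` of (indices of) propositional letters: a nonempty set of worlds,
an accessibility relation, and the truth set of every propositional letter. -/
structure KripkeModel (K : Type u) where
  World : Type v
  nonempty : Nonempty World
  R : World → World → Prop
  P : K → World → Prop

/-- The disjoint union of two Kripke models: two worlds are linked by the accessibility relation
iff they come from the same model and are linked there. -/
def KripkeModel.disjointUnion {K : Type u} (M N : KripkeModel.{u, v} K) :
    KripkeModel.{u, v} K where
  World := M.World ⊕ N.World
  nonempty := M.nonempty.map Sum.inl
  R := Sum.LiftRel M.R N.R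
  P := fun k => Sum.elim (M.P k) (N.P k)

/-! ### The modal language -/

/-- The six negative and restoration modalities. Their meaning at a world `w`:
* `diaNeg φ`  : some successor of `w` refutes `φ`;
* `boxNeg φ`  : every successor of `w` refutes `φ`;
* `cons φ`    : `w` refutes `φ`, or every successor satisfies `φ` (white circle with a smile);
* `det φ`     : `w` satisfies `φ`, or every successor refutes `φ` (white circle with a frown);
* `incons φ`  : `w` satisfies `φ`, and some successor refutes `φ` (black circle with a smile);
* `undet φ`   : `w` refutes `φ`, and some successor satisfies `φ` (black circle with a frown). -/
inductive Modality : Type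
  | diaNeg
  | boxNeg
  | cons
  | det
  | incons
  | undet

/-- The language generated from the letters `p_k`, `k ∈ K`, by `⊤`, `⊥`, `∧`, `∨`, classical
negation and the modalities in the restorative similarity type `Λ`. -/
inductive ModalFormula (K : Type u) (Λ : Set Modality) : Type u
  | letter (k : K) : ModalFormula K Λ
  | top : ModalFormula K Λ
  | bot : ModalFormula K Λ
  | and (φ ψ : ModalFormula K Λ) : ModalFormula K Λ
  | or (φ ψ : ModalFormula K Λ) : ModalFormula K Λ
  | neg (φ : ModalFormula K Λ) : ModalFormula K Λ
  | modal (c : Modality) (hc : c ∈ Λ) (φ : ModalFormula K Λ) : ModalFormula K Λ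

/-! ### The first-order language (with equality) -/

/-- One binary relation symbol and one unary relation symbol for each `k ∈ K`. -/
inductive KripkeRelation (K : Type u) : ℕ → Type u
  | acc : KripkeRelation K 2
  | pred (k : K) : KripkeRelation K 1

/-- The first-order signature of Kripke models; there are no function symbols. -/
def kripkeLanguage (K : Type u) : FirstOrder.Language.{0, u} where
  Functions := fun _ => Empty
  Relations := KripkeRelation K

/-- The binary predicate symbol of the signature. -/
def symR (K : Type u) : (kripkeLanguage K).Relations 2 := KripkeRelation.acc

/-- The unary predicate symbol of the letter `p_k`. -/
def symP {K : Type u} (k : K) : (kripkeLanguage K).Relations 1 := KripkeRelation.pred k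

/-- A Kripke model regarded as a first-order structure. -/
instance KripkeModel.toStructure {K : Type u} (M : KripkeModel.{u, v} K) :
    (kripkeLanguage K).Structure M.World where
  funMap := fun f _ => nomatch f
  RelMap := fun r xs =>
    match r, xs with
    | KripkeRelation.acc, xs => M.R (xs 0) (xs 1)
    | KripkeRelation.pred k, xs => M.P k (xs 0)

/-- First-order formulas `α(x)` whose only possible free variable is `x` (the unique element of
`Unit`). -/
abbrev FOFormula (K : Type u) : Type u := (kripkeLanguage K).Formula Unit

/-- `M ⊩ α(x)[w]`. -/
def Holds {K : Type u} (M : KripkeModel.{u, v} K) (α : FOFormula K) (w : M.World) : Prop :=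
  α.Realize (fun _ : Unit => w)

/-- Two formulas `α(x)`, `β(x)` are equivalent: they hold at the same worlds of all models. -/
def Equivalent {K : Type u} (α β : FOFormula K) : Prop :=
  ∀ (M : KripkeModel.{u, v} K) (w : M.World), Holds M α w ↔ Holds M β w

/-! ### The standard translation -/

section Translation

variable {K : Type u} {n : ℕ}

/-- The atomic formula `P_k x`. Variables are either the free variable (`Sum.inl ()`) or one of
the `n` variables that are to be bound by enclosing quantifiers. -/
def atomP (k : K) (x : Unit ⊕ Fin n) : (kripkeLanguage K).BoundedFormula Unit n :=
  (symP k).boundedFormula₁ (FirstOrder.Language.Term.var x)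

/-- The atomic formula `x R y`. -/
def atomR (x y : Unit ⊕ Fin n) : (kripkeLanguage K).BoundedFormula Unit n :=
  (symR K).boundedFormula₂
    (FirstOrder.Language.Term.var x) (FirstOrder.Language.Term.var y)

/-- The formula `x = x`. -/
def selfEq (x : Unit ⊕ Fin n) : (kripkeLanguage K).BoundedFormula Unit n :=
  FirstOrder.Language.Term.bdEqual (FirstOrder.Language.Term.var x) (FirstOrder.Language.Term.var x)

/-- The variable `x`, seen in the scope of one more quantifier. -/
def old (x : Unit ⊕ Fin n) : Unit ⊕ Fin (n + 1) := Sum.map id Fin.castSucc x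

/-- The variable bound by the innermost quantifier. -/
def fresh : Unit ⊕ Fin (n + 1) := Sum.inr (Fin.last n)

/-- `(∃ y) (x R y ∧ β)`, where `β` may mention the variable `y = fresh`. -/
def exSucc (x : Unit ⊕ Fin n) (β : (kripkeLanguage K).BoundedFormula Unit (n + 1)) :
    (kripkeLanguage K).BoundedFormula Unit n :=
  (atomR (old x) fresh ⊓ β).ex

/-- `(∀ y) (x R y → β)`, where `β` may mention the variable `y = fresh`. -/
def allSucc (x : Unit ⊕ Fin n) (β : (kripkeLanguage K).BoundedFormula Unit (n + 1)) :
    (kripkeLanguage K).BoundedFormula Unit n :=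
  ((atomR (old x) fresh).imp β).all

/-- The standard translation `st(x, φ)`. -/
def st {Λ : Set Modality} :
    {n : ℕ} → (Unit ⊕ Fin n) → ModalFormula K Λ → (kripkeLanguage K).BoundedFormula Unit n
  | _, x, .letter k => atomP k x
  | _, x, .top => selfEq x
  | _, x, .bot => (selfEq x).not
  | _, x, .and φ ψ => st x φ ⊓ st x ψ
  | _, x, .or φ ψ => st x φ ⊔ st x ψ
  | _, x, .neg φ => (st x φ).not
  | _, x, .modal .diaNeg _ φ => exSucc x (st fresh φ).not
  | _, x, .modal .boxNeg _ φ => allSucc x (st fresh φ).not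
  | _, x, .modal .cons _ φ => (st x φ).not ⊔ allSucc x (st fresh φ)
  | _, x, .modal .det _ φ => st x φ ⊔ allSucc x (st fresh φ).not
  | _, x, .modal .incons _ φ => st x φ ⊓ exSucc x (st fresh φ).not
  | _, x, .modal .undet _ φ => (st x φ).not ⊓ exSucc x (st fresh φ)

/-- The standard translation of `φ` at the free variable `x`. -/
def standardTranslation {Λ : Set Modality} (φ : ModalFormula K Λ) : FOFormula K :=
  st (n := 0) (Sum.inl ()) φ

end Translation

/-! ### Simulations -/

/-- The simulation condition attached to each modality. -/
def SimCondition {K : Type u} (M : KripkeModel.{u, v} K) (S : M.World → M.World → Prop) :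
    Modality → Prop
  | .diaNeg => ∀ w v s, S w v → M.R w s → ∃ t, M.R v t ∧ S t s
  | .boxNeg => ∀ w v t, S w v → M.R v t → ∃ s, M.R w s ∧ S t s
  | .cons => ∀ w v t, S w v → M.R v t → S v t ∨ (S v w ∧ ∃ s, M.R w s ∧ S s t)
  | .det => ∀ w v t, S w v → M.R v t → S t v ∨ ∃ s, M.R w s ∧ S t s
  | .incons => ∀ w v s, S w v → M.R w s → S w s ∨ ∃ t, M.R v t ∧ S t s
  | .undet => ∀ w v s, S w v → M.R w s → S s w ∨ (S v w ∧ ∃ t, M.R v t ∧ S s t)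

/-- `S` is a `Λ`-simulation on `M`. -/
structure IsSimulation {K : Type u} (Λ : Set Modality) (M : KripkeModel.{u, v} K)
    (S : M.World → M.World → Prop) : Prop where
  letter : ∀ (k : K) (w v : M.World), S w v → M.P k w → M.P k v
  modal : ∀ c ∈ Λ, SimCondition M S c

/-- `S` is a symmetrical `Λ`-simulation on `M`. -/
structure IsSymmetricalSimulation {K : Type u} (Λ : Set Modality) (M : KripkeModel.{u, v} K)
    (S : M.World → M.World → Prop) : Prop extends IsSimulation Λ M S where
  symm : ∀ w v, S w v → S v w

/-- A symmetrical `Λ`-simulation between two models is one on their disjoint union. -/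
def IsSymmetricalSimulationBetween {K : Type u} (Λ : Set Modality) (M N : KripkeModel.{u, v} K)
    (S : (M.disjointUnion N).World → (M.disjointUnion N).World → Prop) : Prop :=
  IsSymmetricalSimulation Λ (M.disjointUnion N) S

/-- `α(x)` is invariant under symmetrical `Λ`-simulations (between Kripke models). -/
def IsInvariant {K : Type u} (Λ : Set Modality) (α : FOFormula K) : Prop :=
  ∀ (M N : KripkeModel.{u, v} K)
    (S : (M.disjointUnion N).World → (M.disjointUnion N).World → Prop),
    IsSymmetricalSimulationBetween Λ M N S →
    ∀ (w : M.World) (w' : N.World), S (Sum.inl w) (Sum.inr w') →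
      (Holds M α w ↔ Holds N α w')

end Restorative

namespace Restorative

open FirstOrder FirstOrder.Language Filter

/-! ### Semantics of the modal language -/

/-! One direction is an induction on modal formulas (`IsSymmetricalSimulation.sat`); symmetry of the
simulation handles classical negation.

The converse is a van Benthem argument by contradiction. `α` sees only a countable set `A` of
letters (`exists_holds_restrict_iff`), and the modal formulas over `A` can be listed as `θ 0, θ 1,
…`. If no modal formula defines `α`, then for each `n` some two pointed models agree on the first
`n` formulas but not on `α`; otherwise `α` would be a Boolean combination of those formulas
(`IsFragment.exists_define`). By Łoś's theorem, the ultraproducts of the two sequences agree on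
every `θ j` and still disagree on `α`.

Ultraproducts over a nonprincipal ultrafilter on ℕ are modally saturated
(`isSaturated_ultraproduct`), and between saturated models agreement on all `θ j` satisfies the
simulation conditions (`IsSaturated.simCondition`). Letters outside `A` may still be told apart, so
they are emptied first, which does not affect `α`. Invariance is then contradicted. -/

/-- Truth of a modal formula at a world. -/
def Sat {K : Type u} {Λ : Set Modality} (M : KripkeModel.{u, v} K) :
    ModalFormula K Λ → M.World → Prop
  | .letter k, w => M.P k w
  | .top, _ => True
  | .bot, _ => False
  | .and φ ψ, w => Sat M φ w ∧ Sat M ψ w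
  | .or φ ψ, w => Sat M φ w ∨ Sat M ψ w
  | .neg φ, w => ¬ Sat M φ w
  | .modal .diaNeg _ φ, w => ∃ s, M.R w s ∧ ¬ Sat M φ s
  | .modal .boxNeg _ φ, w => ∀ s, M.R w s → ¬ Sat M φ s
  | .modal .cons _ φ, w => ¬ Sat M φ w ∨ ∀ s, M.R w s → Sat M φ s
  | .modal .det _ φ, w => Sat M φ w ∨ ∀ s, M.R w s → ¬ Sat M φ s
  | .modal .incons _ φ, w => Sat M φ w ∧ ∃ s, M.R w s ∧ ¬ Sat M φ s
  | .modal .undet _ φ, w => ¬ Sat M φ w ∧ ∃ s, M.R w s ∧ Sat M φ s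

section Semantics

variable {K : Type u} {Λ : Set Modality} {M N : KripkeModel.{u, v} K}

theorem relMap_acc (xs : Fin 2 → M.World) :
    Structure.RelMap (symR K) xs ↔ M.R (xs 0) (xs 1) := Iff.rfl

theorem relMap_pred (k : K) (xs : Fin 1 → M.World) :
    Structure.RelMap (symP k) xs ↔ M.P k (xs 0) := Iff.rfl

section Realize

variable {n : ℕ} (e : Unit → M.World) (xs : Fin n → M.World) (x : Unit ⊕ Fin n)

theorem elim_snoc_old (a : M.World) :
    Sum.elim e (Fin.snoc xs a : Fin (n + 1) → M.World) (old x) = Sum.elim e xs x := by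
  rcases x with x | x <;> simp [old]

theorem elim_snoc_fresh (a : M.World) :
    Sum.elim e (Fin.snoc xs a : Fin (n + 1) → M.World) fresh = a := by
  simp [fresh]

theorem realize_exSucc (β : (kripkeLanguage K).BoundedFormula Unit (n + 1)) :
    (exSucc x β).Realize e xs ↔
      ∃ s, M.R (Sum.elim e xs x) s ∧ β.Realize e (Fin.snoc xs s) := by
  simp [exSucc, atomR, relMap_acc, elim_snoc_old, elim_snoc_fresh]

theorem realize_allSucc (β : (kripkeLanguage K).BoundedFormula Unit (n + 1)) :
    (allSucc x β).Realize e xs ↔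
      ∀ s, M.R (Sum.elim e xs x) s → β.Realize e (Fin.snoc xs s) := by
  simp [allSucc, atomR, relMap_acc, elim_snoc_old, elim_snoc_fresh]

end Realize

theorem realize_st (φ : ModalFormula K Λ) :
    ∀ {n : ℕ} (e : Unit → M.World) (xs : Fin n → M.World) (x : Unit ⊕ Fin n),
      (st x φ).Realize e xs ↔ Sat M φ (Sum.elim e xs x) := by
  induction φ with
  | letter k => intro n e xs x; simp [st, Sat, atomP, relMap_pred]
  | top => intro n e xs x; simp [st, Sat, selfEq]
  | bot => intro n e xs x; simp [st, Sat, selfEq]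
  | and φ ψ ihφ ihψ => intro n e xs x; simp [st, Sat, ihφ, ihψ]
  | or φ ψ ihφ ihψ => intro n e xs x; simp [st, Sat, ihφ, ihψ]
  | neg φ ih => intro n e xs x; simp [st, Sat, ih]
  | modal c hc φ ih =>
    intro n e xs x
    cases c <;> simp [st, Sat, ih, realize_exSucc, realize_allSucc, elim_snoc_fresh]

theorem holds_standardTranslation (φ : ModalFormula K Λ) (w : M.World) :
    Holds M (standardTranslation φ) w ↔ Sat M φ w :=
  realize_st φ _ _ _

theorem disjointUnion_succ_inl {w : M.World} {x : (M.disjointUnion N).World} :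
    (M.disjointUnion N).R (Sum.inl w) x ↔ ∃ s, x = Sum.inl s ∧ M.R w s := by
  constructor
  · rintro (h | h)
    exact ⟨_, rfl, ‹_›⟩
  · rintro ⟨s, rfl, h⟩
    exact .inl h

theorem disjointUnion_succ_inr {w : N.World} {x : (M.disjointUnion N).World} :
    (M.disjointUnion N).R (Sum.inr w) x ↔ ∃ s, x = Sum.inr s ∧ N.R w s := by
  constructor
  · rintro (h | h)
    exact ⟨_, rfl, ‹_›⟩
  · rintro ⟨s, rfl, h⟩
    exact .inr h

/-- Bounded morphisms preserve and reflect modal formulas. -/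
theorem sat_boundedMorphism {f : M.World → N.World} (hP : ∀ k w, N.P k (f w) ↔ M.P k w)
    (hR : ∀ w x, N.R (f w) x ↔ ∃ s, x = f s ∧ M.R w s) (φ : ModalFormula K Λ) :
    ∀ w, Sat N φ (f w) ↔ Sat M φ w := by
  have hex (w : M.World) (p : N.World → Prop) :
      (∃ x, N.R (f w) x ∧ p x) ↔ ∃ s, M.R w s ∧ p (f s) := by
    simp only [hR]
    constructor
    · rintro ⟨_, ⟨s, rfl, h⟩, hp⟩
      exact ⟨s, h, hp⟩
    · rintro ⟨s, h, hp⟩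
      exact ⟨_, ⟨s, rfl, h⟩, hp⟩
  have hall (w : M.World) (p : N.World → Prop) :
      (∀ x, N.R (f w) x → p x) ↔ ∀ s, M.R w s → p (f s) := by
    simp only [hR]
    constructor
    · exact fun h s hs => h _ ⟨s, rfl, hs⟩
    · rintro h _ ⟨s, rfl, hs⟩
      exact h s hs
  induction φ with
  | letter k => exact hP k
  | top => exact fun _ => Iff.rfl
  | bot => exact fun _ => Iff.rfl
  | and φ ψ ihφ ihψ => intro w; simp only [Sat, ihφ, ihψ]
  | or φ ψ ihφ ihψ => intro w; simp only [Sat, ihφ, ihψ]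
  | neg φ ih => intro w; simp only [Sat, ih]
  | modal c hc φ ih => intro w; cases c <;> simp only [Sat, hex, hall, ih]

theorem sat_disjointUnion_inl (φ : ModalFormula K Λ) (w : M.World) :
    Sat (M.disjointUnion N) φ (Sum.inl w) ↔ Sat M φ w :=
  sat_boundedMorphism (N := M.disjointUnion N) (f := Sum.inl) (fun _ _ => Iff.rfl)
    (fun _ _ => disjointUnion_succ_inl) φ w

theorem sat_disjointUnion_inr (φ : ModalFormula K Λ) (w : N.World) :
    Sat (M.disjointUnion N) φ (Sum.inr w) ↔ Sat N φ w :=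
  sat_boundedMorphism (N := M.disjointUnion N) (f := Sum.inr) (fun _ _ => Iff.rfl)
    (fun _ _ => disjointUnion_succ_inr) φ w

/-- Symmetrical simulations preserve modal formulas. -/
theorem IsSymmetricalSimulation.sat {S : M.World → M.World → Prop}
    (hS : IsSymmetricalSimulation Λ M S) (φ : ModalFormula K Λ) :
    ∀ w v, S w v → Sat M φ w → Sat M φ v := by
  induction φ with
  | letter k => exact hS.letter k
  | top => intros; trivial
  | bot => exact fun _ _ _ h => h
  | and φ ψ ihφ ihψ => exact fun w v h hw => ⟨ihφ w v h hw.1, ihψ w v h hw.2⟩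
  | or φ ψ ihφ ihψ => exact fun w v h hw => hw.imp (ihφ w v h) (ihψ w v h)
  | neg φ ih => exact fun w v h hw hv => hw (ih v w (hS.symm w v h) hv)
  | modal c hc φ ih =>
    intro w v h hw
    have hvw := hS.symm w v h
    have hmod := hS.modal c hc
    have ih' : ∀ x y, S x y → Sat M φ y → Sat M φ x := fun x y hxy => ih y x (hS.symm x y hxy)
    cases c with
    | diaNeg =>
      obtain ⟨s, hws, hs⟩ := hw
      obtain ⟨t, hvt, hts⟩ := hmod w v s h hws
      exact ⟨t, hvt, fun ht => hs (ih t s hts ht)⟩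
    | boxNeg =>
      intro t hvt ht
      obtain ⟨s, hws, hts⟩ := hmod w v t h hvt
      exact hw s hws (ih t s hts ht)
    | cons =>
      refine or_iff_not_imp_left.2 fun hv t hvt => ?_
      have hv := not_not.1 hv
      rcases hmod w v t h hvt with hvt' | ⟨-, s, hws, hst⟩
      · exact ih v t hvt' hv
      · exact ih s t hst (hw.resolve_left (not_not.2 (ih v w hvw hv)) s hws)
    | det =>
      refine or_iff_not_imp_left.2 fun hv t hvt ht => ?_
      rcases hmod w v t h hvt with htv | ⟨s, hws, hts⟩
      · exact hv (ih t v htv ht)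
      · exact hw.resolve_left (fun hw => hv (ih w v h hw)) s hws (ih t s hts ht)
    | incons =>
      obtain ⟨hw, s, hws, hs⟩ := hw
      refine ⟨ih w v h hw, ?_⟩
      rcases hmod w v s h hws with h' | ⟨t, hvt, hts⟩
      · exact absurd (ih w s h' hw) hs
      · exact ⟨t, hvt, fun ht => hs (ih t s hts ht)⟩
    | undet =>
      obtain ⟨hw, s, hws, hs⟩ := hw
      refine ⟨fun hv => hw (ih v w hvw hv), ?_⟩
      rcases hmod w v s h hws with h' | ⟨-, t, hvt, hst⟩
      · exact absurd (ih s w h' hs) hw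
      · exact ⟨t, hvt, ih s t hst hs⟩

end Semantics

theorem isInvariant_of_equivalent {K : Type u} {Λ : Set Modality} {α : FOFormula K}
    {φ : ModalFormula K Λ} (h : Equivalent.{u, v} α (standardTranslation φ)) :
    IsInvariant.{u, v} Λ α := by
  intro M N S hS w w' hww'
  rw [h M w, h N w', holds_standardTranslation, holds_standardTranslation,
    ← sat_disjointUnion_inl (N := N), ← sat_disjointUnion_inr (M := M)]
  exact ⟨hS.sat φ _ _ hww', hS.sat φ _ _ (hS.symm _ _ hww')⟩

/-! ### The finite support of a first-order formula -/

/-- The model obtained by emptying the truth sets of all letters outside `A`. -/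
def KripkeModel.restrict {K : Type u} (M : KripkeModel.{u, v} K) (A : Set K) :
    KripkeModel.{u, v} K where
  World := M.World
  nonempty := M.nonempty
  R := M.R
  P := fun k w => k ∈ A ∧ M.P k w

/-- Without function symbols every term is a variable. -/
theorem realize_term_eq {K : Type u} {γ : Type*} {W : Type v}
    (s₁ s₂ : (kripkeLanguage K).Structure W) (e : γ → W) (t : (kripkeLanguage K).Term γ) :
    @Term.realize _ W s₁ _ e t = @Term.realize _ W s₂ _ e t := by
  cases t with
  | var => rfl
  | func f => exact nomatch f

/-- The letters occurring in `β` suffice. Allowing every `B ⊇ A` lets both halves of an implication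
share the union of their supports. -/
theorem exists_support {K : Type u} {γ : Type*} {n : ℕ}
    (β : (kripkeLanguage K).BoundedFormula γ n) :
    ∃ A : Set K, A.Countable ∧ ∀ B, A ⊆ B → ∀ (M : KripkeModel.{u, v} K) (e : γ → M.World)
      (xs : Fin n → M.World),
      @BoundedFormula.Realize _ M.World (M.restrict B).toStructure _ _ β e xs ↔
        @BoundedFormula.Realize _ M.World M.toStructure _ _ β e xs := by
  induction β with
  | falsum => exact ⟨∅, Set.countable_empty, fun _ _ _ _ _ => Iff.rfl⟩
  | equal t₁ t₂ =>
    exact ⟨∅, Set.countable_empty, fun B _ M e xs => iff_of_eq <|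
      congrArg₂ Eq (realize_term_eq _ _ _ t₁) (realize_term_eq _ _ _ t₂)⟩
  | @rel n l r ts =>
    have key (B : Set K) (M : KripkeModel.{u, v} K) (e : _ → M.World) (xs : Fin n → M.World) :
        @BoundedFormula.Realize _ M.World (M.restrict B).toStructure _ _ (.rel r ts) e xs ↔
        (M.restrict B).toStructure.RelMap r
          (fun i => @Term.realize _ M.World M.toStructure _ (Sum.elim e xs) (ts i)) :=
      iff_of_eq <| congrArg ((M.restrict B).toStructure.RelMap r) <|
        funext fun i => realize_term_eq _ _ _ (ts i)
    simp only [key]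
    cases r with
    | acc => exact ⟨∅, Set.countable_empty, fun _ _ _ _ _ => Iff.rfl⟩
    | pred k =>
      exact ⟨{k}, Set.countable_singleton k, fun B hB M e xs =>
        and_iff_right (hB rfl)⟩
  | imp β₁ β₂ ih₁ ih₂ =>
    obtain ⟨A₁, hA₁, h₁⟩ := ih₁
    obtain ⟨A₂, hA₂, h₂⟩ := ih₂
    refine ⟨A₁ ∪ A₂, hA₁.union hA₂, fun B hB M e xs => ?_⟩
    simp only [BoundedFormula.Realize]
    exact imp_congr (h₁ B (Set.subset_union_left.trans hB) M e xs)
      (h₂ B (Set.subset_union_right.trans hB) M e xs)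
  | all β ih =>
    obtain ⟨A, hA, h⟩ := ih
    exact ⟨A, hA, fun B hB M e xs => forall_congr' fun a => h B hB M e (Fin.snoc xs a)⟩

theorem exists_holds_restrict_iff {K : Type u} (α : FOFormula K) :
    ∃ A : Set K, A.Countable ∧ ∀ (M : KripkeModel.{u, v} K) (w : M.World),
      Holds (M.restrict A) α w ↔ Holds M α w := by
  obtain ⟨A, hA, h⟩ := exists_support.{u, v} α
  exact ⟨A, hA, fun M w => h A le_rfl M (fun _ => w) default⟩

/-! ### Countable fragments of the modal language -/

/-- A set of modal formulas that contains the letters from `A` and is closed under all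
connectives. -/
structure IsFragment {K : Type u} {Λ : Set Modality} (A : Set K)
    (C : Set (ModalFormula K Λ)) : Prop where
  letter : ∀ k ∈ A, .letter k ∈ C
  top : .top ∈ C
  bot : .bot ∈ C
  and : ∀ φ ∈ C, ∀ ψ ∈ C, .and φ ψ ∈ C
  or : ∀ φ ∈ C, ∀ ψ ∈ C, .or φ ψ ∈ C
  neg : ∀ φ ∈ C, .neg φ ∈ C
  modal : ∀ c hc, ∀ φ ∈ C, .modal c hc φ ∈ C

/-- Makes the union over `Λ` in `depthFragment` a countable one. -/
instance : Finite Modality :=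
  Finite.of_surjective
    (fun i : Fin 6 => ![Modality.diaNeg, .boxNeg, .cons, .det, .incons, .undet] i) (by
      rintro (_ | _ | _ | _ | _ | _)
      exacts [⟨0, rfl⟩, ⟨1, rfl⟩, ⟨2, rfl⟩, ⟨3, rfl⟩, ⟨4, rfl⟩, ⟨5, rfl⟩])

section Fragment

variable {K : Type u} (Λ : Set Modality) (A : Set K)

/-- The formulas over the letters from `A` of connective depth at most `n`. -/
def depthFragment : ℕ → Set (ModalFormula K Λ)
  | 0 => ModalFormula.letter '' A ∪ {.top, .bot}
  | n + 1 =>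
    depthFragment n ∪ Set.image2 .and (depthFragment n) (depthFragment n) ∪
      Set.image2 .or (depthFragment n) (depthFragment n) ∪ .neg '' depthFragment n ∪
      ⋃ c : Λ, ModalFormula.modal c.1 c.2 '' depthFragment n

variable {A} in
theorem countable_depthFragment (hA : A.Countable) :
    ∀ n, (depthFragment Λ A n).Countable
  | 0 => (hA.image _).union (Set.to_countable _)
  | n + 1 => by
    have ih := countable_depthFragment hA n
    exact (((ih.union (ih.image2 ih _)).union (ih.image2 ih _)).union (ih.image _)).union
      (Set.countable_iUnion fun c => ih.image _)

theorem depthFragment_mono : Monotone (depthFragment Λ A) :=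
  monotone_nat_of_le_succ fun n φ hφ => by simp only [depthFragment, Set.mem_union, hφ, true_or]

theorem isFragment_iUnion_depthFragment : IsFragment A (⋃ n, depthFragment Λ A n) := by
  have pair {φ ψ : ModalFormula K Λ} (hφ : φ ∈ ⋃ n, depthFragment Λ A n)
      (hψ : ψ ∈ ⋃ n, depthFragment Λ A n) :
      ∃ n, φ ∈ depthFragment Λ A n ∧ ψ ∈ depthFragment Λ A n := by
    obtain ⟨m, hm⟩ := Set.mem_iUnion.1 hφ
    obtain ⟨n, hn⟩ := Set.mem_iUnion.1 hψ
    exact ⟨max m n, depthFragment_mono Λ A (le_max_left m n) hm,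
      depthFragment_mono Λ A (le_max_right m n) hn⟩
  constructor
  · exact fun k hk => Set.mem_iUnion.2 ⟨0, .inl ⟨k, hk, rfl⟩⟩
  · exact Set.mem_iUnion.2 ⟨0, .inr (.inl rfl)⟩
  · exact Set.mem_iUnion.2 ⟨0, .inr (.inr rfl)⟩
  · intro φ hφ ψ hψ
    obtain ⟨n, h₁, h₂⟩ := pair hφ hψ
    exact Set.mem_iUnion.2 ⟨n + 1, .inl (.inl (.inl (.inr ⟨φ, h₁, ψ, h₂, rfl⟩)))⟩
  · intro φ hφ ψ hψ
    obtain ⟨n, h₁, h₂⟩ := pair hφ hψ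
    exact Set.mem_iUnion.2 ⟨n + 1, .inl (.inl (.inr ⟨φ, h₁, ψ, h₂, rfl⟩))⟩
  · intro φ hφ
    obtain ⟨n, h⟩ := Set.mem_iUnion.1 hφ
    exact Set.mem_iUnion.2 ⟨n + 1, .inl (.inr ⟨φ, h, rfl⟩)⟩
  · intro c hc φ hφ
    obtain ⟨n, h⟩ := Set.mem_iUnion.1 hφ
    exact Set.mem_iUnion.2 ⟨n + 1, .inr (Set.mem_iUnion.2 ⟨⟨c, hc⟩, φ, h, rfl⟩)⟩

variable {A} in
/-- Over countably many letters there is a fragment enumerated by the natural numbers. -/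
theorem exists_isFragment_range (hA : A.Countable) :
    ∃ θ : ℕ → ModalFormula K Λ, IsFragment A (Set.range θ) := by
  have hC := isFragment_iUnion_depthFragment Λ A
  obtain ⟨θ, hθ⟩ := (Set.countable_iUnion (countable_depthFragment Λ hA)).exists_eq_range
    ⟨_, hC.top⟩
  exact ⟨θ, hθ ▸ hC⟩

end Fragment

/-! ### Definability by agreement on finitely many formulas -/

section Definability

variable {K : Type u} {Λ : Set Modality} {A : Set K} {θ : ℕ → ModalFormula K Λ}

/-- A property of pointed models that only depends on the truth values of finitely many formulas
of a fragment is defined by a formula of the fragment. -/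
theorem IsFragment.exists_define (hθ : IsFragment A (Set.range θ)) (n : ℕ) :
    ∀ Q : (Σ M : KripkeModel.{u, v} K, M.World) → Prop,
      (∀ x y : Σ M : KripkeModel.{u, v} K, M.World,
        (∀ j < n, Sat x.1 (θ j) x.2 ↔ Sat y.1 (θ j) y.2) → Q x → Q y) →
      ∃ φ ∈ Set.range θ, ∀ x, Q x ↔ Sat x.1 φ x.2 := by
  induction n with
  | zero =>
    intro Q hQ
    by_cases h : ∃ x, Q x
    · obtain ⟨x, hx⟩ := h
      exact ⟨_, hθ.top, fun y => iff_of_true (hQ x y (by simp) hx) trivial⟩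
    · exact ⟨_, hθ.bot, fun y => iff_of_false (fun hy => h ⟨y, hy⟩) id⟩
  | succ n ih =>
    intro Q hQ
    -- Case split on the truth value `b` of `θ n`: quantifying over a companion `y` with that value
    -- leaves a property depending only on the first `n` formulas.
    have split (b : Prop) : ∃ φ ∈ Set.range θ, ∀ x : Σ M : KripkeModel.{u, v} K, M.World,
        (∃ y : Σ M : KripkeModel.{u, v} K, M.World,
          (∀ j < n, Sat y.1 (θ j) y.2 ↔ Sat x.1 (θ j) x.2) ∧ (Sat y.1 (θ n) y.2 ↔ b) ∧ Q y) ↔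
        Sat x.1 φ x.2 := by
      refine ih _ ?_
      rintro x x' hx ⟨y, hy, hb, hQy⟩
      exact ⟨y, fun j hj => (hy j hj).trans (hx j hj), hb, hQy⟩
    obtain ⟨φ, hφ, hφQ⟩ := split True
    obtain ⟨ψ, hψ, hψQ⟩ := split False
    have hn : θ n ∈ Set.range θ := ⟨n, rfl⟩
    refine ⟨.or (.and (θ n) φ) (.and (.neg (θ n)) ψ),
      hθ.or _ (hθ.and _ hn _ hφ) _ (hθ.and _ (hθ.neg _ hn) _ hψ), fun x => ?_⟩
    simp only [Sat, ← hφQ, ← hψQ]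
    constructor
    · intro hx
      by_cases h : Sat x.1 (θ n) x.2
      · exact .inl ⟨h, x, fun _ _ => Iff.rfl, iff_of_true h trivial, hx⟩
      · exact .inr ⟨h, x, fun _ _ => Iff.rfl, iff_of_false h id, hx⟩
    · rintro (⟨h, y, hy, hb, hQy⟩ | ⟨h, y, hy, hb, hQy⟩) <;>
      · refine hQ y x (fun j hj => ?_) hQy
        rcases Nat.lt_succ_iff_lt_or_eq.1 hj with hj | rfl
        · exact hy j hj
        · simp [hb, h]

end Definability

/-! ### Ultraproducts of Kripke models -/

section Ultraproduct

variable {K : Type u} {Λ : Set Modality} (M : ℕ → KripkeModel.{u, v} K)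

instance (n : ℕ) : Nonempty (M n).World := (M n).nonempty

/-- The ultraproduct of a sequence of Kripke models modulo a nonprincipal ultrafilter. -/
noncomputable def ultraproduct : KripkeModel.{u, v} K where
  World := (hyperfilter ℕ : Filter ℕ).Product fun n => (M n).World
  nonempty := Ultraproduct.Product.instNonempty
  R := fun x y => (Ultraproduct.structure (L := kripkeLanguage K)).RelMap (symR K) ![x, y]
  P := fun k x => (Ultraproduct.structure (L := kripkeLanguage K)).RelMap (symP k) ![x]

variable {M}

/-- The world of the ultraproduct represented by a sequence of worlds. -/
noncomputable def ultraWorld (f : ∀ n, (M n).World) : (ultraproduct M).World :=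
  Quotient.mk'' f

theorem exists_ultraWorld (x : (ultraproduct M).World) : ∃ f, x = ultraWorld f := by
  obtain ⟨f, hf⟩ := Quotient.exists_rep x
  exact ⟨f, hf.symm⟩

/-- Identifies the structure induced by the Kripke model with the ultraproduct structure, so that
Łoś's theorem applies. -/
theorem ultraproduct_toStructure :
    (ultraproduct M).toStructure =
      (Ultraproduct.structure : (kripkeLanguage K).Structure
        ((hyperfilter ℕ : Filter ℕ).Product fun n => (M n).World)) := by
  refine Structure.ext ?_ ?_
  · funext n f
    exact nomatch f
  · funext n r xs
    cases r with
    | acc =>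
      exact congrArg ((Ultraproduct.structure (L := kripkeLanguage K)).RelMap (symR K))
        -- The tuple rebuilt from its entries is the original one, as seen by listing both.
        (List.ofFn_inj.1 rfl)
    | pred k =>
      exact congrArg ((Ultraproduct.structure (L := kripkeLanguage K)).RelMap (symP k))
        (List.ofFn_inj.1 rfl)

theorem holds_ultraproduct (α : FOFormula K) (f : ∀ n, (M n).World) :
    Holds (ultraproduct M) α (ultraWorld f) ↔ ∀ᶠ n in hyperfilter ℕ, Holds (M n) α (f n) := by
  unfold Holds
  rw [ultraproduct_toStructure]
  exact Ultraproduct.realize_formula_cast α fun _ => f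

theorem sat_ultraproduct (φ : ModalFormula K Λ) (f : ∀ n, (M n).World) :
    Sat (ultraproduct M) φ (ultraWorld f) ↔ ∀ᶠ n in hyperfilter ℕ, Sat (M n) φ (f n) := by
  simp only [← holds_standardTranslation]
  exact holds_ultraproduct _ f

theorem ultraproduct_R (f g : ∀ n, (M n).World) :
    (ultraproduct M).R (ultraWorld f) (ultraWorld g) ↔
      ∀ᶠ n in hyperfilter ℕ, (M n).R (f n) (g n) := by
  have h := Ultraproduct.boundedFormula_realize_cast (u := hyperfilter ℕ) (M := fun n => (M n).World)
    (atomR (K := K) (n := 1) (Sum.inl ()) (Sum.inr 0)) (fun _ => f) (fun _ => g)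
  simp only [atomR, BoundedFormula.realize_rel₂, Term.realize_var, Sum.elim_inl, Sum.elim_inr] at h
  exact h

/-- A model is modally saturated if every countable set of modal formulas that is finitely
satisfiable among the successors of a world is satisfiable among them. -/
def IsSaturated (Λ : Set Modality) (M : KripkeModel.{u, v} K) : Prop :=
  ∀ (w : M.World) (θ : ℕ → ModalFormula K Λ),
    (∀ m, ∃ s, M.R w s ∧ ∀ j < m, Sat M (θ j) s) → ∃ s, M.R w s ∧ ∀ j, Sat M (θ j) s

-- Diagonal argument: at index `n`, choose a successor satisfying as long an initial segment of `θ`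
-- as possible, of length at most `n`. For fixed `j`, almost every `n` admits length `j + 1` and is
-- at least `j + 1`, so `θ j` holds there.
open Classical in
theorem isSaturated_ultraproduct : IsSaturated Λ (ultraproduct M) := by
  intro w θ h
  obtain ⟨f, rfl⟩ := exists_ultraWorld w
  let Q (n m : ℕ) : Prop := ∃ s, (M n).R (f n) s ∧ ∀ j < m, Sat (M n) (θ j) s
  have hQ (m : ℕ) : ∀ᶠ n in hyperfilter ℕ, Q n m := by
    obtain ⟨s, hws, hs⟩ := h m
    obtain ⟨g, rfl⟩ := exists_ultraWorld s
    have hs' : ∀ᶠ n in hyperfilter ℕ, ∀ j ∈ Set.Iio m, Sat (M n) (θ j) (g n) :=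
      (eventually_all_finite (Set.finite_Iio m)).2 fun j hj => (sat_ultraproduct _ _).1 (hs j hj)
    filter_upwards [(ultraproduct_R f g).1 hws, hs'] with n h₁ h₂
    exact ⟨g n, h₁, h₂⟩
  have hge (m : ℕ) : ∀ᶠ n in hyperfilter ℕ, m ≤ n :=
    Nat.hyperfilter_le_atTop (eventually_ge_atTop m)
  -- `Q n 0` says that `f n` has a successor at all; where it fails, `f n` is a dummy value.
  have hg (n : ℕ) : ∃ s, Q n 0 →
      (M n).R (f n) s ∧ ∀ j < Nat.findGreatest (Q n) n, Sat (M n) (θ j) s := by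
    by_cases h0 : Q n 0
    · obtain ⟨s, hs⟩ := Nat.findGreatest_spec (Nat.zero_le n) h0
      exact ⟨s, fun _ => hs⟩
    · exact ⟨f n, fun h => absurd h h0⟩
  choose g hg using hg
  refine ⟨ultraWorld g, (ultraproduct_R f g).2 ?_, fun j => (sat_ultraproduct _ _).2 ?_⟩
  · filter_upwards [hQ 0] with n hn
    exact (hg n hn).1
  · filter_upwards [hQ 0, hQ (j + 1), hge (j + 1)] with n h0 hj hn
    exact (hg n h0).2 j (Nat.le_findGreatest hn hj)

end Ultraproduct

/-! ### Modal equivalence between saturated models -/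

section Saturation

variable {K : Type u} {Λ : Set Modality} {A : Set K} {θ : ℕ → ModalFormula K Λ}
  {M N : KripkeModel.{u, v} K}

/-- Successors stay in their component, and truth is computed there. -/
theorem IsSaturated.disjointUnion (hM : IsSaturated Λ M) (hN : IsSaturated Λ N) :
    IsSaturated Λ (M.disjointUnion N) := by
  rintro (w | w) θ h
  · obtain ⟨s, hws, hs⟩ := hM w θ fun m => by
      obtain ⟨x, hwx, hx⟩ := h m
      obtain ⟨s, rfl, hws⟩ := disjointUnion_succ_inl.1 hwx
      exact ⟨s, hws, fun j hj => (sat_disjointUnion_inl _ _).1 (hx j hj)⟩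
    exact ⟨.inl s, disjointUnion_succ_inl.2 ⟨s, rfl, hws⟩,
      fun j => (sat_disjointUnion_inl _ _).2 (hs j)⟩
  · obtain ⟨s, hws, hs⟩ := hN w θ fun m => by
      obtain ⟨x, hwx, hx⟩ := h m
      obtain ⟨s, rfl, hws⟩ := disjointUnion_succ_inr.1 hwx
      exact ⟨s, hws, fun j hj => (sat_disjointUnion_inr _ _).1 (hx j hj)⟩
    exact ⟨.inr s, disjointUnion_succ_inr.2 ⟨s, rfl, hws⟩,
      fun j => (sat_disjointUnion_inr _ _).2 (hs j)⟩

/-- Two worlds satisfy the same formulas from `C`. -/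
def ModallyEquivalent (M : KripkeModel.{u, v} K) (C : Set (ModalFormula K Λ))
    (w v : M.World) : Prop :=
  ∀ φ ∈ C, Sat M φ w ↔ Sat M φ v

theorem ModallyEquivalent.symm {C : Set (ModalFormula K Λ)} {w v : M.World}
    (h : ModallyEquivalent M C w v) : ModallyEquivalent M C v w :=
  fun φ hφ => (h φ hφ).symm

/-- A formula of a fragment that is true at `w` and false at `v`, for worlds that are not
equivalent. -/
theorem IsFragment.exists_separating {C : Set (ModalFormula K Λ)} (hC : IsFragment A C)
    {w v : M.World} (h : ¬ ModallyEquivalent M C w v) :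
    ∃ χ ∈ C, Sat M χ w ∧ ¬ Sat M χ v := by
  unfold ModallyEquivalent at h
  push Not at h
  obtain ⟨χ, hχ, h | h⟩ := h
  · exact ⟨χ, hχ, h⟩
  · exact ⟨.neg χ, hC.neg χ hχ, h.1, not_not.2 h.2⟩

/-- In a saturated model, a world `w` has a successor equivalent to `t` as soon as every formula
true at `t` is true at some successor of `w`. -/
theorem IsSaturated.exists_equivalent (hM : IsSaturated Λ M) (hθ : IsFragment A (Set.range θ))
    {w t : M.World} (h : ∀ φ ∈ Set.range θ, Sat M φ t → ∃ s, M.R w s ∧ Sat M φ s) :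
    ∃ s, M.R w s ∧ ModallyEquivalent M (Set.range θ) s t := by
  classical
  -- The complete theory of `t` within the fragment; by closure under conjunction, each finite part
  -- of it is a single formula of the fragment.
  let η (j : ℕ) : ModalFormula K Λ := if Sat M (θ j) t then θ j else .neg (θ j)
  have hη (j : ℕ) : Sat M (η j) t := by
    by_cases hj : Sat M (θ j) t
    · simp only [η, if_pos hj, hj]
    · simp only [η, if_neg hj]
      exact hj
  have hηθ (j : ℕ) : η j ∈ Set.range θ := by
    by_cases hj : Sat M (θ j) t
    · simp only [η, if_pos hj, Set.mem_range_self]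
    · simp only [η, if_neg hj]
      exact hθ.neg _ ⟨j, rfl⟩
  have hconj (m : ℕ) : ∃ φ ∈ Set.range θ, ∀ s, Sat M φ s ↔ ∀ j < m, Sat M (η j) s := by
    induction m with
    | zero => exact ⟨_, hθ.top, fun s => iff_of_true trivial (by simp)⟩
    | succ m ih =>
      obtain ⟨φ, hφ, hs⟩ := ih
      refine ⟨.and φ (η m), hθ.and _ hφ _ (hηθ m), fun s => ?_⟩
      simp only [Sat, hs, Nat.lt_succ_iff_lt_or_eq, or_imp, forall_and, forall_eq]
  obtain ⟨s, hws, hs⟩ := hM w η fun m => by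
    obtain ⟨φ, hφ, hφs⟩ := hconj m
    obtain ⟨s, hws, hs⟩ := h φ hφ ((hφs t).2 fun j _ => hη j)
    exact ⟨s, hws, (hφs s).1 hs⟩
  refine ⟨s, hws, ?_⟩
  rintro _ ⟨j, rfl⟩
  have hj := hs j
  by_cases ht : Sat M (θ j) t
  · simp only [η, if_pos ht] at hj
    exact iff_of_true hj ht
  · simp only [η, if_neg ht] at hj
    exact iff_of_false hj ht

/-- If no suitable successor exists, saturation yields a formula `φ` true at the target but at no
candidate, and the modality turns this into a disagreement between `w` and `v`. A restoration
modality also tests its argument at the current world; when the first alternative fails, a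
separating formula `χ` settles that test. -/
theorem IsSaturated.simCondition (hM : IsSaturated Λ M) (hθ : IsFragment A (Set.range θ))
    {c : Modality} (hc : c ∈ Λ) : SimCondition M (ModallyEquivalent M (Set.range θ)) c := by
  have hmod := hθ.modal c hc
  cases c with
  | diaNeg =>
    refine fun w v s hwv hws => hM.exists_equivalent hθ fun φ hφ hs => ?_
    -- Applied to a negation, `diaNeg` is the ordinary diamond.
    obtain ⟨t, hvt, ht⟩ := (hwv _ (hmod _ (hθ.neg φ hφ))).1 ⟨s, hws, not_not.2 hs⟩
    exact ⟨t, hvt, not_not.1 ht⟩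
  | boxNeg =>
    intro w v t hwv hvt
    obtain ⟨s, hws, hst⟩ := hM.exists_equivalent (w := w) hθ fun φ hφ ht => by
      by_contra hcon
      exact (hwv _ (hmod φ hφ)).1 (fun s hws hs => hcon ⟨s, hws, hs⟩) t hvt ht
    exact ⟨s, hws, hst.symm⟩
  | cons =>
    refine fun w v t hwv hvt => or_iff_not_imp_left.2 fun hvt' => ⟨hwv.symm, ?_⟩
    obtain ⟨χ, hχ, hχv, hχt⟩ := hθ.exists_separating hvt'
    refine hM.exists_equivalent hθ fun φ hφ ht => ?_
    by_contra hcon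
    -- `χ ∨ ¬φ` is true at `v` because of `χ`, false at `t`, and true at all successors of `w`.
    have hw := (hwv _ (hmod _ (hθ.or _ hχ _ (hθ.neg φ hφ)))).1
      (.inr fun s hws => .inr fun hs => hcon ⟨s, hws, hs⟩)
    exact (hw.resolve_left (not_not.2 (.inl hχv)) t hvt).elim hχt fun h => h ht
  | det =>
    refine fun w v t hwv hvt => or_iff_not_imp_left.2 fun htv => ?_
    obtain ⟨χ, hχ, hχt, hχv⟩ := hθ.exists_separating htv
    obtain ⟨s, hws, hst⟩ := hM.exists_equivalent (w := w) hθ fun φ hφ ht => by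
      by_contra hcon
      -- Dually, `χ ∧ φ` is false at `v` because of `χ`, true at `t`, and false at all successors of
      -- `w`.
      have hw := (hwv _ (hmod _ (hθ.and _ hχ _ hφ))).1
        (.inr fun s hws hs => hcon ⟨s, hws, hs.2⟩)
      exact hw.resolve_left (fun h => hχv h.1) t hvt ⟨hχt, ht⟩
    exact ⟨s, hws, hst.symm⟩
  | incons =>
    refine fun w v s hwv hws => or_iff_not_imp_left.2 fun hws' => ?_
    obtain ⟨χ, hχ, hχw, hχs⟩ := hθ.exists_separating hws'
    refine hM.exists_equivalent hθ fun φ hφ hs => ?_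
    obtain ⟨-, t, hvt, ht⟩ := (hwv _ (hmod _ (hθ.or _ hχ _ (hθ.neg φ hφ)))).1
      ⟨.inl hχw, s, hws, fun h => h.elim hχs fun h => h hs⟩
    exact ⟨t, hvt, not_not.1 fun h => ht (.inr h)⟩
  | undet =>
    refine fun w v s hwv hws => or_iff_not_imp_left.2 fun hsw => ⟨hwv.symm, ?_⟩
    obtain ⟨χ, hχ, hχs, hχw⟩ := hθ.exists_separating hsw
    obtain ⟨t, hvt, hts⟩ := hM.exists_equivalent (w := v) hθ fun φ hφ hs => by
      obtain ⟨-, t, hvt, ht⟩ := (hwv _ (hmod _ (hθ.and _ hχ _ hφ))).1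
        ⟨fun h => hχw h.1, s, hws, hχs, hs⟩
      exact ⟨t, hvt, ht.2⟩
    exact ⟨t, hvt, hts.symm⟩

/-- Equivalence with respect to a fragment over the letters from `A`, between saturated models,
is a symmetrical simulation between their restrictions to `A`. -/
theorem isSymmetricalSimulationBetween_restrict (hM : IsSaturated Λ M) (hN : IsSaturated Λ N)
    (hθ : IsFragment A (Set.range θ)) :
    IsSymmetricalSimulationBetween Λ (M.restrict A) (N.restrict A)
      (ModallyEquivalent (M.disjointUnion N) (Set.range θ)) where
  letter := by
    have key (k : K) (x : (M.disjointUnion N).World) :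
        ((M.restrict A).disjointUnion (N.restrict A)).P k x ↔
          k ∈ A ∧ (M.disjointUnion N).P k x := by
      rcases x with x | x <;> rfl
    intro k w v hwv hw
    obtain ⟨hk, hw⟩ := (key k w).1 hw
    exact (key k v).2 ⟨hk, (hwv _ (hθ.letter k hk)).1 hw⟩
  modal := by
    intro c hc
    have h := (hM.disjointUnion hN).simCondition hθ hc
    -- Restriction leaves accessibility untouched, so each condition is literally the same.
    cases c <;> exact h
  symm := fun _ _ h => h.symm

end Saturation

theorem exists_equivalent_of_isInvariant {K : Type u} {Λ : Set Modality} {α : FOFormula K}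
    (hα : IsInvariant.{u, v} Λ α) :
    ∃ φ : ModalFormula K Λ, Equivalent.{u, v} α (standardTranslation φ) := by
  obtain ⟨A, hA, hαA⟩ := exists_holds_restrict_iff.{u, v} α
  obtain ⟨θ, hθ⟩ := exists_isFragment_range Λ hA
  by_contra hcon
  have hsep (n : ℕ) : ∃ x y : Σ M : KripkeModel.{u, v} K, M.World,
      (∀ j < n, Sat x.1 (θ j) x.2 ↔ Sat y.1 (θ j) y.2) ∧ Holds x.1 α x.2 ∧ ¬ Holds y.1 α y.2 := by
    by_contra! h
    obtain ⟨φ, -, hφ⟩ := hθ.exists_define n (fun x => Holds x.1 α x.2) h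
    exact hcon ⟨φ, fun M w => (hφ ⟨M, w⟩).trans (holds_standardTranslation φ w).symm⟩
  choose x y hxy hx hy using hsep
  let M := ultraproduct fun n => (x n).1
  let N := ultraproduct fun n => (y n).1
  let w : M.World := ultraWorld fun n => (x n).2
  let w' : N.World := ultraWorld fun n => (y n).2
  have hw : Holds M α w := (holds_ultraproduct _ _).2 (.of_forall hx)
  have hw' : ¬ Holds N α w' := fun h => by
    obtain ⟨n, hn⟩ := ((holds_ultraproduct _ _).1 h).exists
    exact hy n hn
  refine hw' ((hαA N w').1 ((hα (M.restrict A) (N.restrict A) _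
    (isSymmetricalSimulationBetween_restrict isSaturated_ultraproduct isSaturated_ultraproduct hθ)
    w w' ?_).1 ((hαA M w).2 hw)))
  rintro _ ⟨j, rfl⟩
  refine (sat_disjointUnion_inl (M := M) (N := N) (θ j) w).trans
    (Iff.trans ?_ (sat_disjointUnion_inr (M := M) (N := N) (θ j) w').symm)
  refine (sat_ultraproduct _ _).trans (Iff.trans ?_ (sat_ultraproduct _ _).symm)
  refine eventually_congr ?_
  -- Nonprincipality: almost every index exceeds `j`, and there the two models agree on `θ j`.
  filter_upwards [Nat.hyperfilter_le_atTop (eventually_gt_atTop j)] with n hn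
  exact hxy n j hn

end Restorative

theorem theorem7p4 {K : Type u} (Λ : Set Restorative.Modality) (α : Restorative.FOFormula K) :
    (∃ φ : Restorative.ModalFormula K Λ,
        Restorative.Equivalent.{u, max u v} α (Restorative.standardTranslation φ)) ↔
      Restorative.IsInvariant.{u, max u v} Λ α :=
  ⟨fun ⟨_, h⟩ => Restorative.isInvariant_of_equivalent h,
    Restorative.exists_equivalent_of_isInvariant⟩
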